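/- Let $n \ge 2$ and $d \ge 3$ be integers. Suppose $n$ balls are placed sequentially into $n$ bins, labelled by the residues modulo $n$, by balanced allocation with double hashing: the $j$th ball receives two hash values $f(j)$, uniform over $\{0,\dots,n-1\}$, and $g(j)$, uniform over the integers in $[1,n-1]$ that are relatively prime to $n$, all hash values being independent; its $d$ choices are the bins $f(j) + k\,g(j) \bmod n$ for $k = 0,1,\dots,d-1$, and it is placed in a least loaded bin among its choices, with ties broken in an arbitrary (possibly random) way. Then for constant $d$ the maximum load (the largest number of balls in a bin after all $n$ balls have been placed) is at most $\log\log n/\log d + O(d)$ with high probability. Precisely: for every $\alpha > 0$ there is a constant $C$, depending only on $\alpha$, such that for every $d \ge 3$ there is a constant $K$, depending only on $\alpha$ and $d$, such that for all $n \ge 2$ and every tie-breaking $$\Pr\left(\text{maximum load} > \frac{\log\log n}{\log d} + C d\right) \le K\, n^{-\alpha}.$$ -/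

import Mathlib

open MeasureTheory ProbabilityTheory

/-- The two hash values of one ball when there are `n` bins, the bins being `ℤ/nℤ`: a start `f`
in `ℤ/nℤ`, and a step `g` which is a unit of `ℤ/nℤ`. For `n ≥ 2` the units of `ℤ/nℤ` are the
residue classes of the numbers in `[1, n - 1]` that are relatively prime to `n`. -/
@[ext]
structure HashPair (n : ℕ) where
  f : ZMod n
  g : (ZMod n)ˣ

/-- Every set of hash pairs is measurable (there are only finitely many of them when `n ≠ 0`). -/
instance HashPair.instMeasurableSpace (n : ℕ) : MeasurableSpace (HashPair n) := ⊤

/-- The `k`-th choice `h(k) = f + k g mod n` of a ball; its `d` choices are `h(0), …, h(d - 1)`. -/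
def HashPair.choice {n : ℕ} (h : HashPair n) (k : ℕ) : ZMod n :=
  h.f + (k : ZMod n) * (h.g : ZMod n)

/-- `m` balls receive independent hash pairs, each uniform over the `n · φ(n)` possible pairs
`(f, g)` (so that `f` and `g` are also independent of each other). -/
structure IsDoubleHashing {Ω : Type*} [MeasurableSpace Ω] (P : Measure Ω) {m n : ℕ}
    (hash : Fin m → Ω → HashPair n) : Prop where
  measurable : ∀ j, Measurable (hash j)
  indep : iIndepFun hash P
  uniform : ∀ j (h : HashPair n), P.real {ω | hash j ω = h} = 1 / ((n : ℝ) * (n.totient : ℝ))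

/-- The load of bin `x` just before ball `j` is placed, if ball `i` is placed in bin `b i`. -/
def loadBefore {m n : ℕ} (b : Fin m → ZMod n) (j : Fin m) (x : ZMod n) : ℕ :=
  (Finset.univ.filter fun i => i < j ∧ b i = x).card

/-- The balls `0, 1, …, m - 1`, placed in this order, are each placed in a least loaded bin among
their `d` choices. Ties may be broken in any way. -/
def IsBalancedAllocation {m n : ℕ} (d : ℕ) (h : Fin m → HashPair n) (b : Fin m → ZMod n) : Prop :=
  ∀ j, (∃ k < d, b j = (h j).choice k) ∧
    ∀ k < d, loadBefore b j (b j) ≤ loadBefore b j ((h j).choice k)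

/-- The maximum, over all bins, of the number of balls in the bin at the end. -/
def maxLoad {m n : ℕ} [NeZero n] (b : Fin m → ZMod n) : ℕ :=
  Finset.univ.sup fun x : ZMod n => (Finset.univ.filter fun i => b i = x).card

/-!
The proof is a first moment bound over witnesses, as in the witness tree method, arranged so that
the dependence between the choices of one ball is used only through the number of pairs `(f, g)`
with one or two prescribed choices.

**Witnesses.** Let the height of a ball be the number of balls below it. All choices of a ball of
height `a + 1` contain a ball of height `a`. So, below a ball of height `c + r`, there is an
exploration in `r` rounds: the round at height `a` visits all bins discovered so far, finds in each
of them its ball of height `a`, and adds all the choices of these balls to the discovered bins. The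
heights make all the balls found distinct, in a round because they lie in different bins. A ball
that has only the visited bin in common with the bins discovered before it contributes `d - 1` new
bins; any other ball is a *defect*. A round without defects multiplies the number of discovered bins
by `d`, and no round decreases it. Hence, with `r` about `κ + log log n / log d`, there are
either `κ` defects or `t = ⌈log n⌉` discovered bins. In the second case each of these bins
contains `c` balls of height below `c`, which are not part of the exploration, so there is a set of
`c t` further balls that hit the discovered bins (`IsBalancedAllocation.exists_mem_witnessed`).

**First moment.** A given bin is a choice of a given ball with probability at most `d / n`, so each
step of the exploration contributes `n · d / n = d` to the expected number of explorations; a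
defect fixes two choices, which has probability at most `d ^ 3 t / (n φ(n))`. Weighting each defect
by `z = n ^ (1/4)`, which is possible because `n ≤ 2 φ(n) ^ 2`, makes a step contribute at most
`2 d` (`sum_explorations_le`). An exploration stopped as early as possible has at most `t + κ + 1`
balls, so the number of explorations contributes only a power of `n`. This is beaten by `z ^ (-κ)`,
or by the bound `(2 e d / c) ^ (c t)` for the set of further balls (`choose_mul_pow_le`), when `κ`
and `c` are large enough, but still of order `d`; this is the source of the term `O(d)`.
-/

/-! ### Counting hash pairs with prescribed choices -/

noncomputable instance HashPair.instDecidableEq (n : ℕ) : DecidableEq (HashPair n) :=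
  Classical.decEq _

def HashPair.equivProd (n : ℕ) : HashPair n ≃ ZMod n × (ZMod n)ˣ where
  toFun h := (h.f, h.g)
  invFun p := ⟨p.1, p.2⟩
  left_inv _ := rfl
  right_inv _ := rfl

noncomputable instance HashPair.instFintype (n : ℕ) [NeZero n] : Fintype (HashPair n) :=
  Fintype.ofEquiv _ (HashPair.equivProd n).symm

theorem HashPair.card (n : ℕ) [NeZero n] : Fintype.card (HashPair n) = n * n.totient := by
  rw [Fintype.card_congr (HashPair.equivProd n), Fintype.card_prod, ZMod.card,
    ZMod.card_units_eq_totient]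

section HashPairs

variable {n : ℕ}

/-- The set of the `d` choices of a ball. -/
def HashPair.bins (d : ℕ) (x : HashPair n) : Finset (ZMod n) := (Finset.range d).image x.choice

theorem HashPair.mem_bins {d : ℕ} {x : HashPair n} {y : ZMod n} :
    y ∈ x.bins d ↔ ∃ k < d, x.choice k = y := by
  simp [HashPair.bins]

theorem natCast_injOn_of_le {k l d : ℕ} [NeZero n] (hd : d ≤ n) (hk : k < d) (hl : l < d)
    (h : (k : ZMod n) = l) : k = l := by
  rw [ZMod.natCast_eq_natCast_iff', Nat.mod_eq_of_lt (by omega), Nat.mod_eq_of_lt (by omega)] at h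
  exact h

theorem HashPair.card_bins [NeZero n] {d : ℕ} (hd : d ≤ n) (x : HashPair n) :
    (x.bins d).card = d := by
  rw [HashPair.bins, Finset.card_image_of_injOn, Finset.card_range]
  intro k hk l hl h
  simp only [Finset.coe_range, Set.mem_Iio] at hk hl
  simp only [HashPair.choice, add_right_inj, Units.mul_left_inj] at h
  exact natCast_injOn_of_le hd hk hl h

theorem HashPair.card_choice_eq [NeZero n] (k : ℕ) (y : ZMod n) :
    (Finset.univ.filter fun x : HashPair n => x.choice k = y).card ≤ n.totient := by
  rw [← ZMod.card_units_eq_totient n, ← Finset.card_univ]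
  refine Finset.card_le_card_of_injOn HashPair.g (by simp) ?_
  intro x hx x' hx' h
  replace hx : x.f + (k : ZMod n) * x.g = y := (Finset.mem_filter.1 hx).2
  replace hx' : x'.f + (k : ZMod n) * x'.g = y := (Finset.mem_filter.1 hx').2
  refine HashPair.ext ?_ h
  rw [← hx', h] at hx
  exact add_right_cancel hx

/-- The number of hash pairs for which a given bin is among the choices. -/
theorem HashPair.card_mem_bins [NeZero n] (d : ℕ) (y : ZMod n) :
    (Finset.univ.filter fun x : HashPair n => y ∈ x.bins d).card ≤ d * n.totient := by
  have : (Finset.univ.filter fun x : HashPair n => y ∈ x.bins d) ⊆ (Finset.range d).biUnion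
      fun k => Finset.univ.filter fun x : HashPair n => x.choice k = y := by
    intro x
    simp [HashPair.mem_bins]
  refine (Finset.card_le_card this).trans (Finset.card_biUnion_le.trans ?_)
  refine (Finset.sum_le_card_nsmul _ _ _ fun k _ => HashPair.card_choice_eq k y).trans ?_
  simp

theorem ZMod.card_nsmul_eq_le [NeZero n] {m : ℕ} (hm : 0 < m) (e : ZMod n) :
    (Finset.univ.filter fun z : ZMod n => m • z = e).card ≤ m := by
  rcases (Finset.univ.filter fun z : ZMod n => m • z = e).eq_empty_or_nonempty with h | ⟨z₀, h₀⟩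
  · rw [h]; simp
  refine le_trans ?_ (IsAddCyclic.card_nsmul_eq_zero_le (α := ZMod n) hm)
  refine Finset.card_le_card_of_injOn (fun z => z - z₀) ?_ (fun _ _ _ _ h => sub_left_injective h)
  intro z hz
  have h1 := (Finset.mem_filter.1 hz).2
  have h2 := (Finset.mem_filter.1 h₀).2
  refine Finset.mem_filter.2 ⟨Finset.mem_univ _, ?_⟩
  simp only [smul_sub, h1, h2, sub_self]

/-- Two different bins, at two prescribed positions, determine `(l - k) g`, and then `g` up to
`l - k` possibilities, even though `l - k` need not be invertible modulo `n`. -/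
theorem HashPair.card_choice_eq_and_choice_eq [NeZero n] {k l : ℕ} (hkl : k < l) (y z : ZMod n) :
    (Finset.univ.filter fun x : HashPair n => x.choice k = y ∧ x.choice l = z).card ≤ l := by
  refine le_trans ?_ ((ZMod.card_nsmul_eq_le (Nat.sub_pos_of_lt hkl) (z - y)).trans (l.sub_le k))
  refine Finset.card_le_card_of_injOn (fun x => (x.g : ZMod n)) ?_ ?_
  · intro x hx
    obtain ⟨h1, h2⟩ := (Finset.mem_filter.1 hx).2
    refine Finset.mem_filter.2 ⟨Finset.mem_univ _, ?_⟩
    rw [← h1, ← h2, nsmul_eq_mul, Nat.cast_sub hkl.le, HashPair.choice, HashPair.choice]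
    ring
  · intro x hx x' hx' h
    have h1 : x.f + (k : ZMod n) * x.g = y := (Finset.mem_filter.1 hx).2.1
    have h2 : x'.f + (k : ZMod n) * x'.g = y := (Finset.mem_filter.1 hx').2.1
    replace h : (x.g : ZMod n) = x'.g := h
    refine HashPair.ext ?_ (Units.ext h)
    rw [← h2, h] at h1
    exact add_right_cancel h1

/-- The number of hash pairs whose choices include a given bin `y` and a second bin in `Y`. -/
theorem HashPair.card_mem_bins_and_two_le [NeZero n] (d : ℕ) (y : ZMod n) (Y : Finset (ZMod n)) :
    (Finset.univ.filter fun x : HashPair n => y ∈ x.bins d ∧ 2 ≤ (x.bins d ∩ Y).card).card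
      ≤ d ^ 3 * Y.card := by
  have hsub : (Finset.univ.filter fun x : HashPair n =>
      y ∈ x.bins d ∧ 2 ≤ (x.bins d ∩ Y).card) ⊆
      (Finset.range d ×ˢ Finset.range d ×ˢ Y).biUnion fun p =>
        Finset.univ.filter fun x : HashPair n =>
          p.1 ≠ p.2.1 ∧ x.choice p.1 = y ∧ x.choice p.2.1 = p.2.2 := by
    intro x hx
    obtain ⟨h1, h2⟩ := (Finset.mem_filter.1 hx).2
    obtain ⟨k, hk, rfl⟩ := HashPair.mem_bins.1 h1
    obtain ⟨z, hz, hzy⟩ := Finset.exists_mem_ne (by omega : 1 < (x.bins d ∩ Y).card) (x.choice k)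
    obtain ⟨hz1, hz2⟩ := Finset.mem_inter.1 hz
    obtain ⟨l, hl, rfl⟩ := HashPair.mem_bins.1 hz1
    refine Finset.mem_biUnion.2 ⟨(k, l, x.choice l), ?_, ?_⟩
    · simp [hk, hl, hz2]
    · refine Finset.mem_filter.2 ⟨Finset.mem_univ _, ?_, rfl, rfl⟩
      exact fun h => hzy (congrArg x.choice (show k = l from h).symm)
  refine (Finset.card_le_card hsub).trans (Finset.card_biUnion_le.trans ?_)
  refine (Finset.sum_le_card_nsmul _ _ d ?_).trans ?_
  · rintro ⟨k, l, z⟩ hp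
    simp only [Finset.mem_product, Finset.mem_range] at hp
    rcases lt_trichotomy k l with h | h | h
    · refine le_trans (Finset.card_le_card ?_)
        ((HashPair.card_choice_eq_and_choice_eq h y z).trans hp.2.1.le)
      intro x hx
      exact Finset.mem_filter.2 ⟨Finset.mem_univ _, (Finset.mem_filter.1 hx).2.2⟩
    · subst h
      simp
    · refine le_trans (Finset.card_le_card ?_)
        ((HashPair.card_choice_eq_and_choice_eq h z y).trans hp.1.le)
      intro x hx
      exact Finset.mem_filter.2 ⟨Finset.mem_univ _, (Finset.mem_filter.1 hx).2.2.symm⟩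
  · simp only [Finset.card_product, Finset.card_range, smul_eq_mul]
    apply le_of_eq
    ring

end HashPairs

/-! ### A lower bound for the totient -/

/-- The bound for odd numbers is stated separately because the induction needs it: dropping a single
factor `2` does not change the totient. -/
theorem Nat.le_two_mul_totient_sq (n : ℕ) :
    (Odd n → n ≤ n.totient ^ 2) ∧ n ≤ 2 * n.totient ^ 2 := by
  induction n using Nat.strong_induction_on with
  | _ n ih =>
    rcases Nat.lt_or_ge n 2 with h | h
    · interval_cases n <;> simp
    have hp : n.minFac.Prime := Nat.minFac_prime (by omega)
    obtain ⟨m, hm⟩ := n.minFac_dvd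
    generalize n.minFac = p at hp hm
    have hm0 : 0 < m := Nat.pos_of_ne_zero (by rintro rfl; omega)
    have hmn : m < n := by have := hp.two_le; nlinarith
    obtain ⟨h1, h2⟩ := ih m hmn
    have key : p ≠ 2 → ∀ c, m ≤ c * m.totient ^ 2 → n ≤ c * n.totient ^ 2 := by
      intro hp2 c hc
      have hp3 : 3 ≤ p := by have := hp.two_le; omega
      rw [hm]
      by_cases hpm : p ∣ m
      · rw [Nat.totient_mul_of_prime_of_dvd hp hpm]
        calc p * m ≤ p ^ 2 * (c * m.totient ^ 2) := Nat.mul_le_mul (by nlinarith) hc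
          _ = _ := by ring
      · rw [Nat.totient_mul_of_prime_of_not_dvd hp hpm]
        obtain ⟨q, rfl⟩ : ∃ q, p = q + 1 := ⟨p - 1, by omega⟩
        calc (q + 1) * m ≤ q ^ 2 * (c * m.totient ^ 2) := Nat.mul_le_mul (by nlinarith) hc
          _ = _ := by rw [Nat.add_sub_cancel]; ring
    by_cases hp2 : p = 2
    · subst hp2
      refine ⟨fun ho => absurd ho (by rw [hm]; simp), ?_⟩
      rw [hm]
      rcases Nat.even_or_odd m with he | ho
      · rw [Nat.totient_two_mul_of_even he]
        nlinarith
      · rw [Nat.totient_two_mul_of_odd ho]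
        nlinarith [h1 ho]
    · refine ⟨fun ho => ?_, key hp2 2 h2⟩
      have := key hp2 1
      rw [one_mul, one_mul] at this
      exact this (h1 (by rw [hm] at ho; exact (Nat.odd_mul.1 ho).2))

/-! ### Explorations -/

section Exploration

variable {n : ℕ}

/-- The bins discovered by an exploration: all the choices of the balls in the list. Lists of hash
pairs have the most recent ball at their head. -/
def explored (d : ℕ) : List (HashPair n) → Finset (ZMod n)
  | [] => ∅
  | x :: l => x.bins d ∪ explored d l

/-- The bins still to be visited in the current round, the next one first. A round visits every bin
that has been discovered when the round starts, in the order given by `Finset.toList`, and the next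
round starts when the queue runs out. As it is determined by the hash pairs seen so far, the bin
visited next need not be recorded, and a step costs only the `d` possible positions of that bin. -/
noncomputable def queue (d : ℕ) : List (HashPair n) → List (ZMod n)
  | [] => []
  | x :: l => if (queue d l).tail = [] then (explored d (x :: l)).toList else (queue d l).tail

/-- Every ball but the first (for which the queue is empty) has the first bin of the queue among its
choices. -/
def IsExploration (d : ℕ) : List (HashPair n) → Prop
  | [] => True
  | x :: l => IsExploration d l ∧ ∀ y ∈ (queue d l).head?, y ∈ x.bins d

/-- The number of balls of which at least two choices had been discovered before. -/
def defects (d : ℕ) : List (HashPair n) → ℕ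
  | [] => 0
  | x :: l => defects d l + if 2 ≤ (x.bins d ∩ explored d l).card then 1 else 0

theorem queue_ne_nil [NeZero n] {d : ℕ} (hd : 0 < d) {l : List (HashPair n)} (hl : l ≠ []) :
    queue d l ≠ [] := by
  cases l with
  | nil => exact absurd rfl hl
  | cons x l =>
    rw [queue]
    split_ifs with h
    · rw [Ne, Finset.toList_eq_nil, explored, Finset.union_eq_empty, not_and_or]
      refine Or.inl (Finset.ne_empty_of_mem (HashPair.mem_bins.2 ⟨0, hd, rfl⟩))
    · exact h

theorem card_explored_cons_le (d : ℕ) (x : HashPair n) (l : List (HashPair n)) :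
    (explored d (x :: l)).card ≤ d + (explored d l).card := by
  refine (Finset.card_union_le _ _).trans ?_
  gcongr
  exact Finset.card_image_le.trans (by simp)

theorem explored_subset_of_suffix {d : ℕ} {l l' : List (HashPair n)} (h : l <:+ l') :
    explored d l ⊆ explored d l' := by
  induction l' with
  | nil => rw [List.suffix_nil.1 h]
  | cons x l' ih =>
    rcases List.suffix_cons_iff.1 h with rfl | h
    · exact subset_rfl
    · exact (ih h).trans Finset.subset_union_right

theorem defects_le_of_suffix {d : ℕ} {l l' : List (HashPair n)} (h : l <:+ l') :
    defects d l ≤ defects d l' := by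
  induction l' with
  | nil => rw [List.suffix_nil.1 h]
  | cons x l' ih =>
    rcases List.suffix_cons_iff.1 h with rfl | h
    · exact le_rfl
    · exact (ih h).trans (Nat.le_add_right _ _)

theorem IsExploration.of_suffix {d : ℕ} {l l' : List (HashPair n)} (h : l <:+ l')
    (hl : IsExploration d l') : IsExploration d l := by
  induction l' with
  | nil => rw [List.suffix_nil.1 h]; trivial
  | cons x l' ih =>
    rcases List.suffix_cons_iff.1 h with rfl | h
    · exact hl
    · exact ih h hl.1

/-- A ball that is not a defect discovers at least `d - 1` new bins. -/
theorem card_explored_cons_ge [NeZero n] {d : ℕ} (hd₀ : 0 < d) (hd : d ≤ n) (x : HashPair n)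
    (l : List (HashPair n)) :
    (explored d l).card + (d - 1) + (d - 1) * defects d l
      ≤ (explored d (x :: l)).card + (d - 1) * defects d (x :: l) := by
  have h := Finset.card_union_add_card_inter (x.bins d) (explored d l)
  rw [HashPair.card_bins hd] at h
  rw [explored, defects]
  split_ifs with h2
  · have : (explored d l).card ≤ (x.bins d ∪ explored d l).card :=
      Finset.card_le_card Finset.subset_union_right
    rw [mul_add]
    omega
  · rw [add_zero]
    omega

/-- An exploration with few discovered bins and few defects is short. -/
theorem length_mul_le [NeZero n] {d : ℕ} (hd₀ : 0 < d) (hd : d ≤ n) (l : List (HashPair n)) :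
    (d - 1) * l.length ≤ (explored d l).card + (d - 1) * defects d l := by
  induction l with
  | nil => simp
  | cons x l ih =>
    have := card_explored_cons_ge hd₀ hd x l
    rw [List.length_cons, mul_add]
    omega

open Classical in
/-- The hash pairs by which an exploration with fewer than `t` discovered bins can go on. -/
noncomputable def nextPairs [NeZero n] (d t : ℕ) (l : List (HashPair n)) : Finset (HashPair n) :=
  Finset.univ.filter fun x => (explored d l).card < t ∧ ∀ y ∈ (queue d l).head?, y ∈ x.bins d

/-- The explorations with `M` balls that had discovered fewer than `t` bins before their last
ball. -/
noncomputable def explorations [NeZero n] (d t : ℕ) : ℕ → Finset (List (HashPair n))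
  | 0 => {[]}
  | M + 1 => (explorations d t M).biUnion fun l => (nextPairs d t l).image (· :: l)

theorem length_of_mem_explorations [NeZero n] {d t M : ℕ} {l : List (HashPair n)}
    (h : l ∈ explorations d t M) : l.length = M := by
  induction M generalizing l with
  | zero => simp_all [explorations]
  | succ M ih =>
    simp only [explorations, Finset.mem_biUnion, Finset.mem_image] at h
    obtain ⟨l', hl', x, -, rfl⟩ := h
    rw [List.length_cons, ih hl']

theorem mem_explorations [NeZero n] {d t : ℕ} (l : List (HashPair n))
    (hl : IsExploration d l) (hlt : (explored d l.tail).card < t) :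
    l ∈ explorations d t l.length := by
  induction l with
  | nil => simp [explorations]
  | cons x l ih =>
    simp only [List.length_cons, explorations, Finset.mem_biUnion, Finset.mem_image]
    refine ⟨l, ih hl.1 (lt_of_le_of_lt ?_ hlt), x, ?_, rfl⟩
    · exact Finset.card_le_card (explored_subset_of_suffix (List.tail_suffix l))
    · simp only [nextPairs, Finset.mem_filter, Finset.mem_univ, true_and]
      exact ⟨hlt, hl.2⟩

theorem card_explored_lt_of_mem_explorations [NeZero n] {d t M : ℕ} (ht : 0 < t)
    {l : List (HashPair n)} (h : l ∈ explorations d t M) : (explored d l).card < t + d := by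
  cases M with
  | zero =>
    simp only [explorations, Finset.mem_singleton] at h
    subst h
    simp only [explored, Finset.card_empty]
    omega
  | succ M =>
    simp only [explorations, Finset.mem_biUnion, Finset.mem_image, nextPairs, Finset.mem_filter]
      at h
    obtain ⟨l', hl', x, hx, rfl⟩ := h
    have := card_explored_cons_le d x l'
    omega

theorem sum_explorations_succ [NeZero n] (d t M : ℕ) (F : List (HashPair n) → ℝ) :
    ∑ l ∈ explorations d t (M + 1), F l
      = ∑ l ∈ explorations d t M, ∑ x ∈ nextPairs d t l, F (x :: l) := by
  rw [explorations, Finset.sum_biUnion]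
  · refine Finset.sum_congr rfl fun l _ => ?_
    rw [Finset.sum_image]
    intro x _ y _ h
    exact (List.cons.inj h).1
  · intro l _ l' _ h
    rw [Function.onFun, Finset.disjoint_left]
    intro a ha ha'
    obtain ⟨x, -, rfl⟩ := Finset.mem_image.1 ha
    obtain ⟨x', -, h'⟩ := Finset.mem_image.1 ha'
    exact h (List.cons.inj h').2.symm

/-- The weight `z` of a defect is chosen so that the defects contribute no more than the other
continuations. -/
theorem sum_nextPairs_le [NeZero n] {d t : ℕ} (hd : 0 < d) {z : ℝ} (hz : 1 ≤ z)
    (hzt : z * (d ^ 3 * t) ≤ d * n.totient) {l : List (HashPair n)} (hl : l ≠ []) :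
    ∑ x ∈ nextPairs d t l, z ^ defects d (x :: l)
      ≤ z ^ defects d l * (2 * d * n.totient) := by
  classical
  obtain ⟨y, Q, hQ⟩ := List.exists_cons_of_ne_nil (queue_ne_nil hd hl)
  by_cases ht : t ≤ (explored d l).card
  · have : nextPairs d t l = ∅ := by
      ext x
      simp [nextPairs, ht]
    rw [this, Finset.sum_empty]
    positivity
  · have hbound : ∀ x ∈ nextPairs d t l, z ^ defects d (x :: l)
        ≤ z ^ defects d l * (1 + if 2 ≤ (x.bins d ∩ explored d l).card then z else 0) := by
      intro x _
      rw [defects]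
      split_ifs
      · rw [pow_add, pow_one]
        gcongr
        linarith
      · simp
    refine (Finset.sum_le_sum hbound).trans ?_
    rw [← Finset.mul_sum]
    gcongr
    rw [Finset.sum_add_distrib, ← Finset.sum_filter, Finset.sum_const, Finset.sum_const,
      nsmul_eq_mul, nsmul_eq_mul, mul_one]
    have h1 : (nextPairs d t l).card ≤ d * n.totient := by
      refine le_trans (Finset.card_le_card ?_) (HashPair.card_mem_bins d y)
      intro x hx
      have := (Finset.mem_filter.1 hx).2.2
      rw [hQ] at this
      exact Finset.mem_filter.2 ⟨Finset.mem_univ _, this y rfl⟩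
    have h2 : ((nextPairs d t l).filter fun x => 2 ≤ (x.bins d ∩ explored d l).card).card
        ≤ d ^ 3 * t := by
      refine le_trans (Finset.card_le_card ?_)
        ((HashPair.card_mem_bins_and_two_le d y (explored d l)).trans (by gcongr; omega))
      intro x hx
      obtain ⟨hx, hx'⟩ := Finset.mem_filter.1 hx
      have := (Finset.mem_filter.1 hx).2.2
      rw [hQ] at this
      exact Finset.mem_filter.2 ⟨Finset.mem_univ _, this y rfl, hx'⟩
    have h1' : ((nextPairs d t l).card : ℝ) ≤ d * n.totient := by exact_mod_cast h1
    have h2' : (((nextPairs d t l).filter fun x =>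
        2 ≤ (x.bins d ∩ explored d l).card).card : ℝ) ≤ d ^ 3 * t := by exact_mod_cast h2
    have h3 := mul_le_mul_of_nonneg_left h2' (by linarith : (0 : ℝ) ≤ z)
    linarith

/-- The number of explorations in which each defect counts with weight `z`. -/
theorem sum_explorations_le [NeZero n] {d t : ℕ} (hd : 0 < d) {z : ℝ} (hz : 1 ≤ z)
    (hzt : z * (d ^ 3 * t) ≤ d * n.totient) (M : ℕ) :
    ∑ l ∈ explorations (n := n) d t (M + 1), z ^ defects d l
      ≤ n * n.totient * (2 * d * n.totient) ^ M := by
  induction M with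
  | zero =>
    rw [sum_explorations_succ, explorations, Finset.sum_singleton]
    have : ∀ x ∈ nextPairs (n := n) d t [], z ^ defects d [x] = 1 := by
      intro x _
      simp [defects, explored]
    rw [Finset.sum_congr rfl this, Finset.sum_const, nsmul_eq_mul, mul_one, pow_zero, mul_one]
    have := Finset.card_le_univ (nextPairs (n := n) d t [])
    rw [HashPair.card] at this
    exact_mod_cast this
  | succ M ih =>
    rw [sum_explorations_succ]
    have : ∀ l ∈ explorations (n := n) d t (M + 1), ∑ x ∈ nextPairs d t l, z ^ defects d (x :: l)
        ≤ z ^ defects d l * (2 * d * n.totient) := by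
      intro l hl
      refine sum_nextPairs_le hd hz hzt ?_
      rintro rfl
      simpa using length_of_mem_explorations hl
    refine (Finset.sum_le_sum this).trans ?_
    rw [← Finset.sum_mul, pow_succ, ← mul_assoc (_ * _) (_ ^ _)]
    exact mul_le_mul_of_nonneg_right ih (by positivity)

/-- Markov's inequality for the weighted count: each defect costs a factor `z`. -/
theorem card_explorations_le [NeZero n] {d t : ℕ} (hd : 0 < d) {z : ℝ} (hz : 1 ≤ z)
    (hzt : z * (d ^ 3 * t) ≤ d * n.totient) (M κ : ℕ) :
    (((explorations (n := n) d t (M + 1)).filter fun l => κ ≤ defects d l).card : ℝ) * z ^ κ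
      ≤ n * n.totient * (2 * d * n.totient) ^ M := by
  refine le_trans ?_ (sum_explorations_le hd hz hzt M)
  rw [← nsmul_eq_mul, ← Finset.sum_const]
  refine (Finset.sum_le_sum (g := fun l => z ^ defects d l) ?_).trans
    (Finset.sum_le_sum_of_subset_of_nonneg (Finset.filter_subset _ _)
      fun _ _ _ => by positivity)
  intro l hl
  exact pow_le_pow_right₀ hz (Finset.mem_filter.1 hl).2

end Exploration

/-! ### The first moment bound -/

section Counting

variable {n : ℕ}

open Classical in
/-- The number of functions that have prescribed values on the list `v`, and values in `Z` on the
set `S`. -/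
theorem card_filter_map_eq_le {ι X : Type*} [Fintype ι] [Fintype X] {v : List ι} (hv : v.Nodup)
    {l : List X} (hl : l.length = v.length) {S : Finset ι} (hS : ∀ i ∈ S, i ∉ v) (Z : Finset X) :
    (Finset.univ.filter fun h : ι → X => v.map h = l ∧ ∀ i ∈ S, h i ∈ Z).card
        * Fintype.card X ^ (v.length + S.card)
      ≤ Z.card ^ S.card * Fintype.card X ^ Fintype.card ι := by
  set T : ι → Finset X := fun i =>
    if h : i ∈ v then {l[v.idxOf i]'(by rw [hl]; exact List.idxOf_lt_length_iff.2 h)}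
    else if i ∈ S then Z else Finset.univ with hT
  have hsub : (Finset.univ.filter fun h : ι → X => v.map h = l ∧ ∀ i ∈ S, h i ∈ Z)
      ⊆ Fintype.piFinset T := by
    intro h hh
    obtain ⟨h1, h2⟩ := (Finset.mem_filter.1 hh).2
    refine Fintype.mem_piFinset.2 fun i => ?_
    simp only [hT]
    split_ifs with hi hi'
    · subst h1
      simp
    · exact h2 i hi'
    · exact Finset.mem_univ _
  have hcard : (Fintype.piFinset T).card = Z.card ^ S.card
      * Fintype.card X ^ (Finset.univ.filter fun i => i ∉ v ∧ i ∉ S).card := by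
    rw [Fintype.card_piFinset]
    have : ∀ i, (T i).card = (if i ∈ S then Z.card else 1)
        * (if i ∉ v ∧ i ∉ S then Fintype.card X else 1) := by
      intro i
      simp only [hT]
      by_cases hi : i ∈ v
      · have : i ∉ S := fun h => hS i h hi
        simp [hi, this]
      · by_cases hi' : i ∈ S <;> simp [hi, hi']
    rw [Finset.prod_congr rfl fun i _ => this i, Finset.prod_mul_distrib, Finset.prod_ite,
      Finset.prod_ite]
    simp
  have hsum : (Finset.univ.filter fun i => i ∉ v ∧ i ∉ S).card + (v.length + S.card)
      = Fintype.card ι := by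
    have h1 : (v.toFinset ∪ S).card = v.length + S.card := by
      rw [Finset.card_union_of_disjoint, List.toFinset_card_of_nodup hv]
      rw [Finset.disjoint_right]
      intro i hi
      simpa using hS i hi
    have h2 : (Finset.univ.filter fun i => i ∉ v ∧ i ∉ S) = (v.toFinset ∪ S)ᶜ := by
      ext i
      simp
    rw [h2, ← h1, Finset.card_compl, Nat.sub_add_cancel (Finset.card_le_univ _)]
  calc _ ≤ (Fintype.piFinset T).card * Fintype.card X ^ (v.length + S.card) := by
        gcongr
    _ = _ := by rw [hcard, mul_assoc, ← pow_add, hsum]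

/-- A witness for a family of hash pairs: an exploration by distinct balls `v` with at least `κ`
defects, and a set `S` of `s` further balls, each of which has a discovered bin among its
choices. -/
structure IsWitness (d t κ s : ℕ) (h : Fin n → HashPair n) (v : List (Fin n))
    (S : Finset (Fin n)) : Prop where
  nodup : v.Nodup
  isExploration : IsExploration d (v.map h)
  card_explored_tail : (explored d (v.map h).tail).card < t
  le_defects : κ ≤ defects d (v.map h)
  card_eq : S.card = s
  notMem : ∀ i ∈ S, i ∉ v
  inter_nonempty : ∀ i ∈ S, ((h i).bins d ∩ explored d (v.map h)).Nonempty

open Classical in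
/-- The families of hash pairs that have a witness with `M` exploring balls. -/
noncomputable def witnessed [NeZero n] (d t κ s M : ℕ) : Finset (Fin n → HashPair n) :=
  Finset.univ.filter fun h => ∃ v S, v.length = M ∧ IsWitness d t κ s h v S

theorem mem_witnessed [NeZero n] {d t κ s M : ℕ} {h : Fin n → HashPair n} :
    h ∈ witnessed d t κ s M ↔ ∃ v S, v.length = M ∧ IsWitness d t κ s h v S := by
  simp [witnessed]

theorem card_inter_nonempty_le [NeZero n] (d : ℕ) (Y : Finset (ZMod n)) :
    (Finset.univ.filter fun x : HashPair n => (x.bins d ∩ Y).Nonempty).card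
      ≤ d * Y.card * n.totient := by
  have : (Finset.univ.filter fun x : HashPair n => (x.bins d ∩ Y).Nonempty)
      ⊆ Y.biUnion fun y => Finset.univ.filter fun x : HashPair n => y ∈ x.bins d := by
    intro x hx
    obtain ⟨y, hy⟩ := (Finset.mem_filter.1 hx).2
    rw [Finset.mem_inter] at hy
    exact Finset.mem_biUnion.2 ⟨y, hy.2, Finset.mem_filter.2 ⟨Finset.mem_univ _, hy.1⟩⟩
  refine (Finset.card_le_card this).trans (Finset.card_biUnion_le.trans ?_)
  refine (Finset.sum_le_card_nsmul _ _ _ fun y _ => HashPair.card_mem_bins d y).trans ?_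
  apply le_of_eq
  rw [smul_eq_mul]
  ring

open Classical in
/-- First moment bound: sum over the exploring balls, over their hash pairs, and over the sets of
further balls. -/
theorem card_witnessed_mul_le [NeZero n] {d t : ℕ} (ht : 0 < t) (κ s M : ℕ) :
    (witnessed (n := n) d t κ s M).card * (n * n.totient) ^ (M + s)
      ≤ n ^ M * n.choose s * ((explorations (n := n) d t M).filter fun l => κ ≤ defects d l).card
        * (d * (t + d) * n.totient) ^ s * (n * n.totient) ^ n := by
  set E := (explorations (n := n) d t M).filter fun l => κ ≤ defects d l
  set V : Finset (List.Vector (Fin n) M) := Finset.univ.filter fun v => v.toList.Nodup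
  set I : Finset (List.Vector (Fin n) M × Finset (Fin n) × List (HashPair n)) :=
    (V ×ˢ (Finset.univ.powersetCard s) ×ˢ E).filter fun p => ∀ i ∈ p.2.1, i ∉ p.1.toList
  set F : List.Vector (Fin n) M × Finset (Fin n) × List (HashPair n) →
      Finset (Fin n → HashPair n) := fun p => Finset.univ.filter fun h =>
    p.1.toList.map h = p.2.2 ∧
      ∀ i ∈ p.2.1, h i ∈ Finset.univ.filter fun x => (x.bins d ∩ explored d p.2.2).Nonempty
    with hF
  have hsub : witnessed (n := n) d t κ s M ⊆ I.biUnion F := by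
    intro h hh
    obtain ⟨v, S, hv, hw⟩ := mem_witnessed.1 hh
    refine Finset.mem_biUnion.2 ⟨(⟨v, hv⟩, S, v.map h), ?_, ?_⟩
    · refine Finset.mem_filter.2 ⟨?_, hw.notMem⟩
      simp only [Finset.mem_product]
      refine ⟨Finset.mem_filter.2 ⟨Finset.mem_univ _, hw.nodup⟩,
        Finset.mem_powersetCard.2 ⟨Finset.subset_univ _, hw.card_eq⟩,
        Finset.mem_filter.2 ⟨?_, hw.le_defects⟩⟩
      have := mem_explorations _ hw.isExploration hw.card_explored_tail
      rwa [List.length_map, hv] at this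
    · refine Finset.mem_filter.2 ⟨Finset.mem_univ _, rfl, fun i hi => ?_⟩
      exact Finset.mem_filter.2 ⟨Finset.mem_univ _, hw.inter_nonempty i hi⟩
  have hterm : ∀ p ∈ I, (F p).card * (n * n.totient) ^ (M + s)
      ≤ (d * (t + d) * n.totient) ^ s * (n * n.totient) ^ n := by
    rintro ⟨⟨v, hv⟩, S, l⟩ hp
    obtain ⟨hp, hSv⟩ := Finset.mem_filter.1 hp
    simp only [Finset.mem_product] at hp
    obtain ⟨hp1, hp2, hp3⟩ := hp
    have hnd : v.Nodup := (Finset.mem_filter.1 hp1).2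
    have hS := (Finset.mem_powersetCard.1 hp2).2
    have hl := (Finset.mem_filter.1 hp3).1
    have h1 := card_filter_map_eq_le hnd ((length_of_mem_explorations hl).trans hv.symm) hSv
      (Finset.univ.filter fun x => (x.bins d ∩ explored d l).Nonempty)
    rw [HashPair.card, hv, hS, Fintype.card_fin] at h1
    refine le_trans (le_of_eq ?_) (h1.trans ?_)
    · congr!
    gcongr
    refine (card_inter_nonempty_le d _).trans ?_
    gcongr
    exact (card_explored_lt_of_mem_explorations ht hl).le
  have hI : I.card ≤ n ^ M * (n.choose s * E.card) := by
    refine (Finset.card_filter_le _ _).trans ?_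
    rw [Finset.card_product, Finset.card_product, Finset.card_powersetCard, Finset.card_univ,
      Fintype.card_fin]
    gcongr
    refine (Finset.card_le_univ _).trans ?_
    rw [card_vector, Fintype.card_fin]
  calc _ ≤ (∑ p ∈ I, (F p).card) * (n * n.totient) ^ (M + s) := by
        gcongr
        exact (Finset.card_le_card hsub).trans Finset.card_biUnion_le
    _ ≤ I.card * ((d * (t + d) * n.totient) ^ s * (n * n.totient) ^ n) := by
        rw [Finset.sum_mul, ← smul_eq_mul]
        exact Finset.sum_le_card_nsmul _ _ _ hterm
    _ ≤ n ^ M * (n.choose s * E.card) * ((d * (t + d) * n.totient) ^ s * (n * n.totient) ^ n) := by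
        gcongr
    _ = _ := by ring

/-- The probability of a witness: a factor `n` for the first ball, `2 d` for each later ball,
`1 / z` for each defect, and `d (t + d) / n` for each ball of the further set. -/
theorem card_witnessed_le [NeZero n] {d t : ℕ} (hd : 0 < d) (ht : 0 < t) {z : ℝ} (hz : 1 ≤ z)
    (hzt : z * (d ^ 3 * t) ≤ d * n.totient) (κ s M : ℕ) :
    ((witnessed (n := n) d t κ s (M + 1)).card : ℝ) / (n * n.totient) ^ n
      ≤ n * (2 * d) ^ M * (n.choose s * (d * (t + d) / n) ^ s) / z ^ κ := by
  classical
  have hn : (0 : ℝ) < n := by exact_mod_cast NeZero.pos n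
  have hφ : (0 : ℝ) < n.totient := by exact_mod_cast Nat.totient_pos.2 (NeZero.pos n)
  have hzκ : (0 : ℝ) < z ^ κ := by positivity
  have h1 : ((witnessed (n := n) d t κ s (M + 1)).card : ℝ) * (n * n.totient) ^ (M + 1 + s)
      ≤ n ^ (M + 1) * n.choose s
        * ((explorations (n := n) d t (M + 1)).filter fun l => κ ≤ defects d l).card
        * (d * (t + d) * n.totient) ^ s * (n * n.totient) ^ n := by
    exact_mod_cast card_witnessed_mul_le (n := n) (d := d) ht κ s (M + 1)
  have h2 := card_explorations_le (n := n) hd hz hzt M κ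
  rw [div_le_div_iff₀ (by positivity) hzκ]
  refine le_of_mul_le_mul_right ?_ (by positivity : (0 : ℝ) < (n * n.totient) ^ (M + 1 + s))
  calc _ = ((witnessed (n := n) d t κ s (M + 1)).card : ℝ) * (n * n.totient) ^ (M + 1 + s)
          * z ^ κ := by ring
    _ ≤ (n ^ (M + 1) * n.choose s
        * ((explorations (n := n) d t (M + 1)).filter fun l => κ ≤ defects d l).card
        * (d * (t + d) * n.totient) ^ s * (n * n.totient) ^ n) * z ^ κ := by gcongr
    _ = (((explorations (n := n) d t (M + 1)).filter fun l => κ ≤ defects d l).card * z ^ κ)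
        * (n ^ (M + 1) * n.choose s * (d * (t + d) * n.totient) ^ s * (n * n.totient) ^ n) := by
      ring
    _ ≤ (n * n.totient * (2 * d * n.totient) ^ M)
        * (n ^ (M + 1) * n.choose s * (d * (t + d) * n.totient) ^ s * (n * n.totient) ^ n) := by
      gcongr
    _ = _ := by
      generalize (t + d : ℝ) = w
      rw [div_pow]
      field_simp
      ring

end Counting

/-! ### Witnesses of a high load -/

section Existence

variable {m n d : ℕ}

/-- The number of balls below a given ball in its bin, at the time at which it is placed. -/
def ballHeight (b : Fin m → ZMod n) (i : Fin m) : ℕ := loadBefore b i (b i)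

theorem loadBefore_lt_loadBefore (b : Fin m → ZMod n) {i j : Fin m} {y : ZMod n} (hij : i < j)
    (hi : b i = y) : loadBefore b i y < loadBefore b j y := by
  refine Finset.card_lt_card (Finset.ssubset_iff_of_subset ?_ |>.2 ⟨i, ?_, ?_⟩)
  · intro k hk
    simp only [Finset.mem_filter, Finset.mem_univ, true_and] at hk ⊢
    exact ⟨hk.1.trans hij, hk.2⟩
  · simp [hij, hi]
  · simp

/-- The heights of the balls in a bin form an initial segment of the natural numbers. -/
theorem exists_ballHeight_eq (b : Fin m → ZMod n) {j : Fin m} {y : ZMod n} {a : ℕ}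
    (ha : a < loadBefore b j y) : ∃ i, b i = y ∧ ballHeight b i = a := by
  set A := Finset.univ.filter fun i => i < j ∧ b i = y with hA
  have hinj : Set.InjOn (fun i => loadBefore b i y) (A : Set (Fin m)) := by
    intro i hi k hk hik
    have hi' := (Finset.mem_filter.1 hi).2.2
    have hk' := (Finset.mem_filter.1 hk).2.2
    rcases lt_trichotomy i k with h | h | h
    · exact absurd hik (loadBefore_lt_loadBefore b h hi').ne
    · exact h
    · exact absurd hik (loadBefore_lt_loadBefore b h hk').ne'
  have himg : A.image (fun i => loadBefore b i y) = Finset.range A.card := by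
    refine Finset.eq_of_subset_of_card_le ?_ (by rw [Finset.card_image_of_injOn hinj]; simp)
    intro k hk
    obtain ⟨i, hi, rfl⟩ := Finset.mem_image.1 hk
    obtain ⟨hi1, hi2⟩ := (Finset.mem_filter.1 hi).2
    exact Finset.mem_range.2 (loadBefore_lt_loadBefore b hi1 hi2)
  have : a ∈ A.image (fun i => loadBefore b i y) := by
    rw [himg]
    exact Finset.mem_range.2 ha
  obtain ⟨i, hi, rfl⟩ := Finset.mem_image.1 this
  obtain ⟨-, rfl⟩ := (Finset.mem_filter.1 hi).2
  exact ⟨i, rfl, rfl⟩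

/-- The last ball of a fullest bin is as high as the load allows. -/
theorem exists_le_ballHeight [NeZero n] {b : Fin m → ZMod n} {N : ℕ} (h : N < maxLoad b) :
    ∃ i, N ≤ ballHeight b i := by
  obtain ⟨x, -, hx⟩ := Finset.lt_sup_iff.1 h
  set A := Finset.univ.filter fun i => b i = x with hA
  have hne : A.Nonempty := Finset.card_pos.1 (by omega)
  have hmax := A.max'_mem hne
  refine ⟨A.max' hne, ?_⟩
  have hbx : b (A.max' hne) = x := (Finset.mem_filter.1 hmax).2
  have hsub : A.erase (A.max' hne) ⊆ Finset.univ.filter fun i => i < A.max' hne ∧ b i = x := by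
    intro i hi
    obtain ⟨hi1, hi2⟩ := Finset.mem_erase.1 hi
    exact Finset.mem_filter.2 ⟨Finset.mem_univ _,
      lt_of_le_of_ne (A.le_max' i hi2) hi1, (Finset.mem_filter.1 hi2).2⟩
  have := Finset.card_le_card hsub
  rw [Finset.card_erase_of_mem hmax] at this
  rw [ballHeight, hbx, loadBefore]
  omega

theorem mem_explored {l : List (HashPair n)} {y : ZMod n} :
    y ∈ explored d l ↔ ∃ x ∈ l, y ∈ x.bins d := by
  induction l with
  | nil => simp [explored]
  | cons x l ih => simp [explored, ih]

variable {h : Fin m → HashPair n} {b : Fin m → ZMod n}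

theorem IsBalancedAllocation.mem_bins (hb : IsBalancedAllocation d h b) (i : Fin m) :
    b i ∈ (h i).bins d := by
  obtain ⟨k, hk, hbk⟩ := (hb i).1
  exact HashPair.mem_bins.2 ⟨k, hk, hbk.symm⟩

/-- A bin that is discovered by balls of height more than `a` contains a ball of height `a`. -/
theorem IsBalancedAllocation.exists_ballHeight_eq_of_mem_explored
    (hb : IsBalancedAllocation d h b) {v : List (Fin m)} {a : ℕ}
    (hv : ∀ i ∈ v, a < ballHeight b i) {y : ZMod n} (hy : y ∈ explored d (v.map h)) :
    ∃ i, b i = y ∧ ballHeight b i = a := by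
  obtain ⟨x, hx, hy⟩ := mem_explored.1 hy
  obtain ⟨j, hj, rfl⟩ := List.mem_map.1 hx
  obtain ⟨k, hk, rfl⟩ := HashPair.mem_bins.1 hy
  exact exists_ballHeight_eq b ((hv j hj).trans_le ((hb j).2 k hk))

/-- An exploration by distinct balls which is in the course of the round that visits the balls of
height `a`. -/
structure IsRound (d a : ℕ) (h : Fin m → HashPair n) (b : Fin m → ZMod n) (v : List (Fin m)) :
    Prop where
  nodup : v.Nodup
  isExploration : IsExploration d (v.map h)
  le_height : ∀ i ∈ v, a ≤ ballHeight b i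
  notMem_queue : ∀ i ∈ v, ballHeight b i = a → b i ∉ queue d (v.map h)
  nodup_queue : (queue d (v.map h)).Nodup
  exists_of_mem_queue : ∀ y ∈ queue d (v.map h), ∃ i, b i = y ∧ ballHeight b i = a

/-- An exploration by distinct balls of height at least `a` which is at the end of a round. -/
structure IsRoundEnd (d a : ℕ) (h : Fin m → HashPair n) (b : Fin m → ZMod n) (v : List (Fin m)) :
    Prop where
  nodup : v.Nodup
  isExploration : IsExploration d (v.map h)
  le_height : ∀ i ∈ v, a ≤ ballHeight b i
  queue_eq : queue d (v.map h) = (explored d (v.map h)).toList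

theorem IsRoundEnd.isRound (hb : IsBalancedAllocation d h b) {a : ℕ} {v : List (Fin m)}
    (hv : IsRoundEnd d (a + 1) h b v) : IsRound d a h b v where
  nodup := hv.nodup
  isExploration := hv.isExploration
  le_height i hi := (Nat.le_succ a).trans (hv.le_height i hi)
  notMem_queue i hi ha := by
    have := hv.le_height i hi
    omega
  nodup_queue := by
    rw [hv.queue_eq]
    exact Finset.nodup_toList _
  exists_of_mem_queue y hy := by
    rw [hv.queue_eq, Finset.mem_toList] at hy
    exact hb.exists_ballHeight_eq_of_mem_explored hv.le_height hy

/-- A round can be completed, and discovers `d - 1` new bins for each bin that it visits without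
a defect. -/
theorem IsRound.exists_isRoundEnd [NeZero n] (hd₀ : 0 < d) (hd : d ≤ n)
    (hb : IsBalancedAllocation d h b) {a k : ℕ} {v : List (Fin m)} (hv : IsRound d a h b v)
    (hk : (queue d (v.map h)).length = k + 1) :
    ∃ v', v <:+ v' ∧ IsRoundEnd d a h b v' ∧
      (explored d (v.map h)).card + (d - 1) * (k + 1) + (d - 1) * defects d (v.map h)
        ≤ (explored d (v'.map h)).card + (d - 1) * defects d (v'.map h) := by
  induction k generalizing v with
  | zero =>
    obtain ⟨y, hy⟩ := List.length_eq_one_iff.1 hk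
    obtain ⟨i, rfl, hi⟩ := hv.exists_of_mem_queue y (by simp [hy])
    refine ⟨i :: v, List.suffix_cons _ _, ⟨List.nodup_cons.2 ⟨fun hiv => ?_, hv.nodup⟩,
      ⟨hv.isExploration, ?_⟩, ?_, ?_⟩, ?_⟩
    · exact hv.notMem_queue i hiv hi (by simp [hy])
    · rw [hy]
      rintro y ⟨⟩
      exact hb.mem_bins i
    · simpa [hi] using hv.le_height
    · simp [queue, hy]
    · have := card_explored_cons_ge hd₀ hd (h i) (v.map h)
      simpa using this
  | succ k ih =>
    obtain ⟨y, Q, hy⟩ := List.exists_cons_of_length_eq_add_one hk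
    obtain ⟨i, rfl, hi⟩ := hv.exists_of_mem_queue y (by simp [hy])
    have hQ : Q.length = k + 1 := by
      rw [hy] at hk
      simpa using hk
    have hQ' : Q ≠ [] := by
      rintro rfl
      simp at hQ
    have hq : queue d ((i :: v).map h) = Q := by
      rw [List.map_cons, queue, hy, List.tail_cons, if_neg hQ']
    have hnd := hv.nodup_queue
    rw [hy, List.nodup_cons] at hnd
    have hround : IsRound d a h b (i :: v) := by
      refine ⟨List.nodup_cons.2 ⟨fun hiv => ?_, hv.nodup⟩, ⟨hv.isExploration, ?_⟩, ?_, ?_, ?_, ?_⟩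
      · exact hv.notMem_queue i hiv hi (by simp [hy])
      · rw [hy]
        rintro y ⟨⟩
        exact hb.mem_bins i
      · simpa [hi] using hv.le_height
      · rw [hq]
        intro j hj hja
        rcases List.mem_cons.1 hj with rfl | hj
        · exact hnd.1
        · have := hv.notMem_queue j hj hja
          rw [hy, List.mem_cons, not_or] at this
          exact this.2
      · rw [hq]
        exact hnd.2
      · rw [hq]
        intro y hyQ
        exact hv.exists_of_mem_queue y (by simp [hy, hyQ])
    obtain ⟨v', hv', hend, hle⟩ := ih hround (by rw [hq, hQ])
    refine ⟨v', (List.suffix_cons _ _).trans hv', hend, ?_⟩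
    have := card_explored_cons_ge hd₀ hd (h i) (v.map h)
    rw [List.map_cons] at hle
    rw [mul_add _ (k + 1)]
    omega

/-- With `r` rounds below a ball of height at least `a + r`, the number of discovered bins is
multiplied by `d` in each round without a defect. -/
theorem IsBalancedAllocation.exists_isRoundEnd [NeZero n] (hd₀ : 0 < d) (hd : d ≤ n)
    (hb : IsBalancedAllocation d h b) {a r : ℕ} {i : Fin m} (hi : a + r ≤ ballHeight b i) :
    ∃ v, IsRoundEnd d a h b v ∧
      d ^ (r + 1) ≤ (explored d (v.map h)).card * d ^ defects d (v.map h) := by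
  induction r generalizing a with
  | zero =>
    refine ⟨[i], ⟨by simp, ⟨trivial, by simp [queue]⟩, by simpa using hi, by simp [queue]⟩, ?_⟩
    simp [explored, defects, HashPair.card_bins hd]
  | succ r ih =>
    obtain ⟨v, hv, hcard⟩ := ih (a := a + 1) (by omega)
    have hpos : 0 < (explored d (v.map h)).card := by
      refine Nat.pos_of_ne_zero fun h0 => ?_
      rw [h0, zero_mul] at hcard
      have : 0 < d ^ (r + 1) := by positivity
      omega
    obtain ⟨k, hk⟩ := Nat.exists_eq_add_one_of_ne_zero hpos.ne'
    obtain ⟨v', hvv', hend, hle⟩ := (hv.isRound hb).exists_isRoundEnd hd₀ hd hb (k := k)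
      (by rw [hv.queue_eq, Finset.length_toList, hk])
    refine ⟨v', hend, ?_⟩
    have hsuf : v.map h <:+ v'.map h := hvv'.map h
    have h1 := Finset.card_le_card (explored_subset_of_suffix (d := d) hsuf)
    rw [← hk] at hle
    rw [pow_succ]
    rcases (defects_le_of_suffix (d := d) hsuf).eq_or_lt with h2 | h2
    · rw [h2] at hle
      have h3 : (explored d (v.map h)).card * d ≤ (explored d (v'.map h)).card := by
        obtain ⟨e, rfl⟩ : ∃ e, d = e + 1 := ⟨d - 1, by omega⟩
        rw [Nat.add_sub_cancel] at hle
        nlinarith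
      calc _ ≤ (explored d (v.map h)).card * d ^ defects d (v.map h) * d := by gcongr
        _ = (explored d (v.map h)).card * d * d ^ defects d (v'.map h) := by rw [h2]; ring
        _ ≤ _ := by gcongr
    · calc _ ≤ (explored d (v.map h)).card * d ^ defects d (v.map h) * d := by gcongr
        _ = (explored d (v.map h)).card * d ^ (defects d (v.map h) + 1) := by rw [pow_succ]; ring
        _ ≤ _ := by
          gcongr
          exact h2

/-- A list with a property that fails for the empty list has a suffix with which the property starts
to hold. -/
theorem List.exists_cons_suffix {α : Type*} {p : List α → Prop} (h0 : ¬p []) {l : List α}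
    (hl : p l) : ∃ x l', x :: l' <:+ l ∧ p (x :: l') ∧ ¬p l' := by
  induction l with
  | nil => exact absurd hl h0
  | cons x l ih =>
    by_cases h : p l
    · obtain ⟨x', l', h1, h2⟩ := ih h
      exact ⟨x', l', h1.trans (List.suffix_cons _ _), h2⟩
    · exact ⟨x, l, List.suffix_rfl, hl, h⟩

/-- A bin discovered by balls of height at least `c` contains a ball of each height below `c`. -/
theorem IsBalancedAllocation.card_low_balls_ge (hb : IsBalancedAllocation d h b)
    {c : ℕ} {v : List (Fin m)} (hv : ∀ i ∈ v, c ≤ ballHeight b i) :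
    c * (explored d (v.map h)).card ≤
      (Finset.univ.filter fun i => b i ∈ explored d (v.map h) ∧ ballHeight b i < c).card := by
  have := Finset.card_le_card_of_surjOn (s := Finset.univ.filter fun i =>
    b i ∈ explored d (v.map h) ∧ ballHeight b i < c) (t := explored d (v.map h) ×ˢ Finset.range c)
    (fun i => (b i, ballHeight b i)) ?_
  · rw [Finset.card_product, Finset.card_range] at this
    linarith
  · rintro ⟨y, a⟩ hya
    simp only [Finset.coe_product, Set.mem_prod, Finset.mem_coe, Finset.mem_range] at hya
    obtain ⟨i, rfl, rfl⟩ := hb.exists_ballHeight_eq_of_mem_explored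
      (fun i hi => hya.2.trans_le (hv i hi)) hya.1
    exact ⟨i, by simpa using hya, rfl⟩

/-- A high load has a witness: either many defects, or many discovered bins and, in these, many
balls that are too low to belong to the exploration. -/
theorem IsBalancedAllocation.exists_mem_witnessed [NeZero n] {h : Fin n → HashPair n}
    {b : Fin n → ZMod n} (hd₂ : 2 ≤ d) (hd : d ≤ n) (hb : IsBalancedAllocation d h b)
    {c r t κ L : ℕ} (ht : 0 < t) (hκ : 0 < κ) (htL : t ≤ d ^ L) (hr : κ + L ≤ r)
    (hmax : c + r < maxLoad b) :
    ∃ M ≤ t + κ, h ∈ witnessed d t κ 0 (M + 1) ∨ h ∈ witnessed d t 0 (c * t) (M + 1) := by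
  obtain ⟨i, hi⟩ := exists_le_ballHeight hmax
  obtain ⟨v, hv, hcard⟩ := hb.exists_isRoundEnd (by omega) hd hi
  have hreach : κ ≤ defects d (v.map h) ∨ t ≤ (explored d (v.map h)).card := by
    by_contra! hlt
    have h1 : d ^ (r + 1) < t * d ^ κ := by
      refine hcard.trans_lt ?_
      refine Nat.mul_lt_mul_of_lt_of_le hlt.2 (Nat.pow_le_pow_right (by omega) hlt.1.le) ?_
      positivity
    have h2 : t * d ^ κ ≤ d ^ (r + 1) := by
      calc t * d ^ κ ≤ d ^ L * d ^ κ := by gcongr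
        _ = d ^ (L + κ) := by rw [pow_add]
        _ ≤ _ := Nat.pow_le_pow_right (by omega) (by omega)
    omega
  -- Stop the exploration with the ball `j` that brings the number of defects to `κ`, or the number
  -- of discovered bins to `t`, so that its length is bounded.
  obtain ⟨j, w, hsuf, hreach, hgo⟩ := List.exists_cons_suffix
    (p := fun v => κ ≤ defects d (v.map h) ∨ t ≤ (explored d (v.map h)).card)
    (by simp [defects, explored]; omega) hreach
  simp only [not_or, not_le] at hgo
  have hnd : (j :: w).Nodup := hsuf.sublist.nodup hv.nodup
  have hexp : IsExploration d ((j :: w).map h) := hv.isExploration.of_suffix (hsuf.map h)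
  have hheight : ∀ i ∈ j :: w, c ≤ ballHeight b i := fun i hi => hv.le_height i (hsuf.subset hi)
  refine ⟨w.length, ?_, ?_⟩
  · have h1 := length_mul_le (by omega) hd (w.map h)
    rw [List.length_map] at h1
    obtain ⟨e, rfl⟩ : ∃ e, d = e + 2 := ⟨d - 2, by omega⟩
    have h2 : (e + 2 - 1) = e + 1 := rfl
    rw [h2] at h1
    by_contra! hlt
    nlinarith
  · rcases hreach with hdef | hexpl
    · left
      exact mem_witnessed.2 ⟨j :: w, ∅, rfl, hnd, hexp, hgo.2, hdef, rfl,
        by simp, by simp⟩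
    · right
      have h1 := hb.card_low_balls_ge hheight
      obtain ⟨S, hS, hScard⟩ := Finset.exists_subset_card_eq
        ((Nat.mul_le_mul_left c hexpl).trans h1)
      refine mem_witnessed.2 ⟨j :: w, S, rfl, hnd, hexp, hgo.2,
        Nat.zero_le _, hScard, fun i hi hi' => ?_, fun i hi => ?_⟩
      · have := (Finset.mem_filter.1 (hS hi)).2.2
        have := hheight i hi'
        omega
      · exact ⟨b i, Finset.mem_inter.2 ⟨hb.mem_bins i, (Finset.mem_filter.1 (hS hi)).2.1⟩⟩

end Existence

/-! ### Uniformity of the hash pairs -/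

section Probability

variable {Ω : Type*} [MeasurableSpace Ω] {P : Measure Ω}

/-- Under double hashing, the family of all hash pairs is uniformly distributed. -/
theorem IsDoubleHashing.measureReal_mem_le {m n : ℕ} [IsProbabilityMeasure P]
    {hash : Fin m → Ω → HashPair n} (hh : IsDoubleHashing P hash)
    (B : Finset (Fin m → HashPair n)) :
    P.real {ω | (fun j => hash j ω) ∈ B} ≤ B.card / (n * n.totient : ℝ) ^ m := by
  have hset : {ω | (fun j => hash j ω) ∈ B} = ⋃ x ∈ B, ⋂ j, hash j ⁻¹' {x j} := by
    ext ω
    simp only [Set.mem_ofPred_eq, Set.mem_iUnion, Set.mem_iInter, Set.mem_preimage,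
      Set.mem_singleton_iff, exists_prop]
    constructor
    · exact fun h => ⟨_, h, fun _ => rfl⟩
    · rintro ⟨x, hx, h⟩
      rwa [funext h]
  have hterm : ∀ x ∈ B, P.real (⋂ j, hash j ⁻¹' {x j}) = 1 / (n * n.totient : ℝ) ^ m := by
    intro x _
    have h1 : P (⋂ j, hash j ⁻¹' {x j}) = ∏ j, P (hash j ⁻¹' {x j}) :=
      hh.indep.meas_iInter fun j => ⟨{x j}, trivial, rfl⟩
    rw [measureReal_def, h1, ENNReal.toReal_prod]
    have h2 : ∀ j, (P (hash j ⁻¹' {x j})).toReal = 1 / (n * n.totient : ℝ) := fun j =>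
      hh.uniform j (x j)
    rw [Finset.prod_congr rfl fun j _ => h2 j, Finset.prod_const, Finset.card_univ,
      Fintype.card_fin, one_div_pow]
  rw [hset]
  refine (measureReal_biUnion_finset_le _ _).trans ?_
  rw [Finset.sum_congr rfl hterm, Finset.sum_const, nsmul_eq_mul, mul_one_div]

end Probability

/-! ### Estimates -/

section Numbers

theorem pow_self_div_factorial_le_exp (s : ℕ) :
    (s : ℝ) ^ s / s.factorial ≤ Real.exp 1 ^ s := by
  have := Real.pow_div_factorial_le_exp (x := s) (Nat.cast_nonneg s) s
  rwa [← Real.exp_one_pow] at this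

/-- If `s = c₀ d t` with `c₀ ≥ 2 e²` and `t ≥ log n`, then the expected number of sets of `s` balls
that all have one of at most `2 t` given bins among their choices is at most `n ^ (-c₀ d)`. -/
theorem choose_mul_pow_le {n d t c₀ : ℕ} (hn : 0 < n) (hc₀ : 15 ≤ c₀) (hdt : d ≤ t)
    (ht : Real.log n ≤ t) :
    (n.choose (c₀ * d * t) : ℝ) * (d * (t + d) / n) ^ (c₀ * d * t) ≤ 1 / (n : ℝ) ^ (c₀ * d) := by
  have hn' : (0 : ℝ) < n := by exact_mod_cast hn
  have hc : (15 : ℝ) ≤ c₀ := by exact_mod_cast hc₀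
  have hdt' : (d : ℝ) ≤ t := by exact_mod_cast hdt
  -- `7.5 = 15 / 2`, so that `2 d t ≤ s / e ^ 2`.
  have he : Real.exp 1 * Real.exp 1 ≤ 7.5 := by
    have := Real.exp_one_lt_d9
    have := Real.exp_pos 1
    nlinarith
  set s := c₀ * d * t with hs
  have hs' : (s : ℝ) = c₀ * d * t := by rw [hs]; push_cast; ring
  have h1 : (d * (t + d) : ℝ) ≤ s / (Real.exp 1 * Real.exp 1) := by
    rw [le_div_iff₀ (by positivity), hs']
    calc (d * (t + d) : ℝ) * (Real.exp 1 * Real.exp 1) ≤ d * (t + t) * 7.5 := by gcongr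
      _ = 15 * d * t := by ring
      _ ≤ _ := by gcongr
  calc (n.choose s : ℝ) * (d * (t + d) / n) ^ s
      ≤ (n ^ s / s.factorial) * (s / (Real.exp 1 * Real.exp 1) / n) ^ s := by
        gcongr
        exact Nat.choose_le_pow_div s n
    _ = (s ^ s / s.factorial) / (Real.exp 1 ^ s * Real.exp 1 ^ s) := by
        rw [div_pow, div_pow, mul_pow]
        field_simp
    _ ≤ Real.exp 1 ^ s / (Real.exp 1 ^ s * Real.exp 1 ^ s) := by
        gcongr
        exact pow_self_div_factorial_le_exp s
    _ = 1 / (Real.exp t) ^ (c₀ * d) := by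
        rw [← Real.exp_one_pow, ← pow_mul, mul_comm t, ← hs]
        field_simp
    _ ≤ _ := by
        gcongr
        rwa [← Real.log_le_iff_le_exp hn']

theorem two_mul_pow_le {n d t : ℕ} (hd : 0 < d) (hn : 0 < n) (ht : (t : ℝ) ≤ Real.log n + 1) :
    (2 * d : ℝ) ^ t ≤ 2 * d * (n : ℝ) ^ (2 * d) := by
  have hn' : (0 : ℝ) < n := by exact_mod_cast hn
  have hlogn : 0 ≤ Real.log n := Real.log_natCast_nonneg n
  have hd' : (1 : ℝ) ≤ d := by exact_mod_cast hd
  have hlog : Real.log (2 * d) ≤ 2 * d := by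
    have := Real.log_le_sub_one_of_pos (x := 2 * d) (by positivity)
    linarith
  rw [← Real.exp_log (by positivity : (0 : ℝ) < (2 * d : ℝ) ^ t),
    ← Real.exp_log (by positivity : (0 : ℝ) < 2 * d * (n : ℝ) ^ (2 * d))]
  refine Real.exp_le_exp.2 ?_
  rw [Real.log_mul (by positivity) (by positivity), Real.log_pow, Real.log_pow]
  have h0 : 0 ≤ Real.log (2 * d) := Real.log_nonneg (by linarith)
  push_cast
  nlinarith

/-- The weight `z = n ^ (1/4)` satisfies the condition of `sum_explorations_le`. -/
theorem le_totient_of_pow_four {n d t : ℕ} {z : ℝ} (hz : 0 ≤ z) (hzn : z ^ 4 = n)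
    (hzt : 2 * d ^ 2 * t ≤ z) : z * (d ^ 3 * t) ≤ d * n.totient := by
  have h1 : (n : ℝ) ≤ 2 * (n.totient : ℝ) ^ 2 := by exact_mod_cast (Nat.le_two_mul_totient_sq n).2
  have h2 : z * (d ^ 2 * t) ≤ n.totient := by
    refine (le_trans ?_ (?_ : z * (z / 2) ≤ _))
    · gcongr
      linarith
    · refine le_of_sq_le_sq ?_ (by positivity)
      nlinarith [sq_nonneg (n.totient : ℝ)]
  calc z * (d ^ 3 * t) = d * (z * (d ^ 2 * t)) := by ring
    _ ≤ _ := by gcongr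

/-- The conditions that make a number of bins large enough for the first moment bound. -/
theorem eventually_log_bounds (d κ : ℕ) : ∀ᶠ n : ℕ in Filter.atTop,
    (d : ℝ) ≤ Real.log n ∧ 1 ≤ Real.log n ∧ 4 * d ^ 2 * Real.log n ≤ (n : ℝ) ^ (1 / 4 : ℝ) ∧
      d ≤ n ∧ 2 * (κ + 1) ≤ n := by
  have hlog : Filter.Tendsto (fun n : ℕ => Real.log n) Filter.atTop Filter.atTop :=
    Real.tendsto_log_atTop.comp tendsto_natCast_atTop_atTop
  have hlit := ((isLittleO_log_rpow_atTop (r := 1 / 4) (by norm_num)).comp_tendsto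
    (tendsto_natCast_atTop_atTop (R := ℝ))).bound (c := 1 / (4 * d ^ 2 + 1)) (by positivity)
  filter_upwards [hlog.eventually_ge_atTop (d : ℝ), hlog.eventually_ge_atTop 1, hlit,
    Filter.eventually_ge_atTop d, Filter.eventually_ge_atTop (2 * (κ + 1))] with n h1 h2 h3 h4 h5
  refine ⟨h1, h2, ?_, h4, h5⟩
  simp only [Function.comp, Real.norm_eq_abs] at h3
  rw [abs_of_nonneg (by linarith), abs_of_nonneg (by positivity), one_div_mul_eq_div,
    le_div_iff₀ (by positivity)] at h3
  linarith

theorem natCeil_log_le_pow {n d : ℕ} (hd : 2 ≤ d) (hn : 1 ≤ Real.log n) :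
    ⌈Real.log n⌉₊ ≤ d ^ (⌈Real.log (Real.log n) / Real.log d⌉₊ + 1) := by
  have hd' : (2 : ℝ) ≤ d := by exact_mod_cast hd
  have hlogd : 0 < Real.log d := Real.log_pos (by linarith)
  set x := Real.log (Real.log n) / Real.log d with hx
  have h1 : Real.log n ≤ (d : ℝ) ^ ⌈x⌉₊ := by
    rw [← Real.log_le_log_iff (by linarith) (by positivity), Real.log_pow, ← div_le_iff₀ hlogd]
    exact Nat.le_ceil _
  refine Nat.ceil_le.2 (h1.trans ?_)
  push_cast
  exact pow_le_pow_right₀ (by linarith) (Nat.le_succ _)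

end Numbers

/-! ### The maximum load -/

open Classical in
/-- The families of hash pairs that have a witness of one of the two kinds: many defects, or `t`
discovered bins with `s` further balls. -/
noncomputable def badFamilies (n : ℕ) [NeZero n] (d t κ s : ℕ) : Finset (Fin n → HashPair n) :=
  (Finset.range (t + κ + 1)).biUnion fun M =>
    witnessed d t κ 0 (M + 1) ∪ witnessed d t 0 s (M + 1)

/-- The exponent `N` makes up for the factors `n ^ (2 d)` for the steps of the exploration, `n` for
its first ball and `n` for the choice of its length, with `n ^ (-(A + 1))` left over. -/
theorem card_badFamilies_le {n d A N : ℕ} [NeZero n] (hd : 0 < d) (hN : N = A + 2 * d + 3)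
    (h1 : (d : ℝ) ≤ Real.log n) (h2 : 1 ≤ Real.log n)
    (h3 : 4 * d ^ 2 * Real.log n ≤ (n : ℝ) ^ (1 / 4 : ℝ)) (h4 : 2 * (4 * N + 1) ≤ n) :
    ((badFamilies n d ⌈Real.log n⌉₊ (4 * N) ((15 + A) * d * ⌈Real.log n⌉₊)).card : ℝ)
      / (n * n.totient) ^ n ≤ 2 * (2 * d) ^ (4 * N + 1) / n ^ A := by
  have hn : 0 < n := NeZero.pos n
  have hn₁ : (1 : ℝ) ≤ n := by exact_mod_cast hn
  have hd₁ : (1 : ℝ) ≤ d := by exact_mod_cast hd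
  have hφ : (0 : ℝ) < n.totient := by exact_mod_cast Nat.totient_pos.2 hn
  set t := ⌈Real.log n⌉₊
  have ht : Real.log n ≤ t := Nat.le_ceil _
  have ht' : (t : ℝ) ≤ Real.log n + 1 := (Nat.ceil_lt_add_one (by linarith)).le
  have ht₀ : 0 < t := Nat.ceil_pos.2 (by linarith)
  have hdt : d ≤ t := by exact_mod_cast h1.trans ht
  set z : ℝ := (n : ℝ) ^ (1 / 4 : ℝ) with hz
  have hz₁ : 1 ≤ z := Real.one_le_rpow hn₁ (by norm_num)
  have hzn : z ^ 4 = n := by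
    rw [hz, ← Real.rpow_natCast, ← Real.rpow_mul (by positivity)]
    norm_num
  have hzt : 2 * d ^ 2 * t ≤ z := by
    refine le_trans ?_ h3
    calc (2 * d ^ 2 * t : ℝ) ≤ 2 * d ^ 2 * (2 * Real.log n) := by gcongr; linarith
      _ = _ := by ring
  have hzn' : z ≤ n := by
    rw [← hzn]
    exact le_self_pow₀ hz₁ (by norm_num)
  have hmul : z * (d ^ 3 * t) ≤ d * n.totient := le_totient_of_pow_four (by linarith) hzn hzt
  have hrange : ((t + 4 * N + 1 : ℕ) : ℝ) ≤ n := by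
    have : (2 * (4 * N + 1) : ℝ) ≤ n := by exact_mod_cast h4
    have : (2 * t : ℝ) ≤ 2 * d ^ 2 * t := by
      nlinarith [mul_nonneg (sub_nonneg.2 (one_le_pow₀ hd₁ : (1 : ℝ) ≤ d ^ 2)) t.cast_nonneg]
    push_cast
    linarith
  have hpow : ∀ M ∈ Finset.range (t + 4 * N + 1), (n : ℝ) * (2 * d) ^ M / n ^ N
      ≤ (2 * d) ^ (4 * N + 1) / n ^ (A + 1) / n := by
    intro M hM
    have hM : M ≤ t + 4 * N := by
      have := Finset.mem_range.1 hM
      omega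
    calc (n : ℝ) * (2 * d) ^ M / n ^ N ≤ n * (2 * d) ^ (t + 4 * N) / n ^ N := by
          gcongr
          linarith
      _ = n * ((2 * d) ^ t * (2 * d) ^ (4 * N)) / n ^ N := by rw [pow_add]
      _ ≤ n * (2 * d * n ^ (2 * d) * (2 * d) ^ (4 * N)) / n ^ N := by
          gcongr
          exact two_mul_pow_le hd hn ht'
      _ = (2 * d) ^ (4 * N + 1) / n ^ (A + 1) / n := by
          rw [hN]
          field_simp
          ring
  have hterm : ∀ M ∈ Finset.range (t + 4 * N + 1),
      (((witnessed (n := n) d t (4 * N) 0 (M + 1) ∪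
        witnessed d t 0 ((15 + A) * d * t) (M + 1)).card : ℕ) : ℝ) / (n * n.totient) ^ n
      ≤ 2 * ((2 * d) ^ (4 * N + 1) / n ^ (A + 1) / n) := by
    intro M hM
    have hdef := card_witnessed_le (n := n) hd ht₀ hz₁ hmul (4 * N) 0 M
    have hleaf := card_witnessed_le (n := n) hd ht₀ hz₁ hmul 0 ((15 + A) * d * t) M
    rw [pow_mul, hzn, Nat.choose_zero_right, pow_zero, Nat.cast_one, mul_one, mul_one] at hdef
    rw [pow_zero, div_one] at hleaf
    have hleaf' : (n : ℝ) * (2 * d) ^ M *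
        (n.choose ((15 + A) * d * t) * (d * (t + d) / n) ^ ((15 + A) * d * t))
        ≤ n * (2 * d) ^ M / n ^ N := by
      rw [div_eq_mul_one_div _ ((n : ℝ) ^ N)]
      gcongr
      refine (choose_mul_pow_le hn (by omega) hdt ht).trans ?_
      gcongr
      rw [hN]
      nlinarith
    have hcard : (((witnessed (n := n) d t (4 * N) 0 (M + 1) ∪
        witnessed d t 0 ((15 + A) * d * t) (M + 1)).card : ℕ) : ℝ)
        ≤ (witnessed (n := n) d t (4 * N) 0 (M + 1)).card
          + (witnessed (n := n) d t 0 ((15 + A) * d * t) (M + 1)).card := by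
      exact_mod_cast Finset.card_union_le _ _
    refine (div_le_div_of_nonneg_right hcard (by positivity)).trans ?_
    rw [add_div]
    have := hpow M hM
    linarith
  calc _ ≤ (∑ M ∈ Finset.range (t + 4 * N + 1), (((witnessed (n := n) d t (4 * N) 0 (M + 1) ∪
        witnessed d t 0 ((15 + A) * d * t) (M + 1)).card : ℕ) : ℝ)) / (n * n.totient) ^ n := by
        gcongr
        exact_mod_cast Finset.card_biUnion_le
    _ ≤ (t + 4 * N + 1 : ℕ) * (2 * ((2 * d) ^ (4 * N + 1) / n ^ (A + 1) / n)) := by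
        rw [Finset.sum_div]
        refine (Finset.sum_le_card_nsmul _ _ _ hterm).trans ?_
        rw [Finset.card_range, nsmul_eq_mul]
    _ ≤ n * (2 * ((2 * d) ^ (4 * N + 1) / n ^ (A + 1) / n)) := by gcongr
    _ = 2 * (2 * d) ^ (4 * N + 1) / n ^ (A + 1) := by field_simp
    _ ≤ _ := by
        gcongr
        exact Nat.le_succ A

/-- The height needed is `(15 + A) d` for the low balls, `4 N` for the rounds with defects, and
`⌈log log n / log d⌉ + 1` for the rounds without. -/
theorem IsBalancedAllocation.mem_badFamilies {n d A N : ℕ} [NeZero n] {h : Fin n → HashPair n}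
    {b : Fin n → ZMod n} (hd₂ : 2 ≤ d) (hd : d ≤ n) (hN : N = A + 2 * d + 3)
    (hlog : 1 ≤ Real.log n) (hb : IsBalancedAllocation d h b)
    (hmax : Real.log (Real.log n) / Real.log d + (5 * A + 40 : ℕ) * d < maxLoad b) :
    h ∈ badFamilies n d ⌈Real.log n⌉₊ (4 * N) ((15 + A) * d * ⌈Real.log n⌉₊) := by
  have ht₀ : 0 < ⌈Real.log n⌉₊ := Nat.ceil_pos.2 (by linarith)
  have hd₁ : (2 : ℝ) ≤ d := by exact_mod_cast hd₂
  have hx : 0 ≤ Real.log (Real.log n) / Real.log d :=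
    div_nonneg (Real.log_nonneg hlog) (Real.log_nonneg (by linarith))
  have hL := Nat.ceil_lt_add_one hx
  have hcast : ((15 + A) * d + (4 * N + (⌈Real.log (Real.log n) / Real.log d⌉₊ + 1)) : ℕ)
      < maxLoad b := by
    rw [← Nat.cast_lt (α := ℝ)]
    refine lt_of_le_of_lt ?_ hmax
    have hN' : (N : ℝ) = A + 2 * d + 3 := by rw [hN]; push_cast; rfl
    push_cast
    rw [hN']
    nlinarith [mul_nonneg (Nat.cast_nonneg (α := ℝ) A) (by linarith : (0 : ℝ) ≤ d - 1)]
  obtain ⟨M, hM, hw⟩ := hb.exists_mem_witnessed hd₂ hd ht₀ (by omega : 0 < 4 * N)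
    (natCeil_log_le_pow hd₂ hlog) le_rfl hcast
  exact Finset.mem_biUnion.2 ⟨M, Finset.mem_range.2 (by omega), Finset.mem_union.2 hw⟩

theorem mainTheorem4 :
    ∀ α : ℝ, 0 < α → ∃ C : ℝ, ∀ d : ℕ, 3 ≤ d → ∃ K : ℝ, ∀ (n : ℕ) [NeZero n], 2 ≤ n →
      ∀ {Ω : Type*} [MeasurableSpace Ω] (P : Measure Ω) [IsProbabilityMeasure P]
        (hash : Fin n → Ω → HashPair n) (bin : Fin n → Ω → ZMod n),
        IsDoubleHashing P hash →
        (∀ᵐ ω ∂P, IsBalancedAllocation d (fun j => hash j ω) (fun j => bin j ω)) →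
        P.real {ω | Real.log (Real.log n) / Real.log d + C * d < maxLoad (fun j => bin j ω)}
          ≤ K * (n : ℝ) ^ (-α) := by
  intro α hα
  set A := ⌈α⌉₊
  have hαA : α ≤ A := Nat.le_ceil α
  refine ⟨(5 * A + 40 : ℕ), fun d hd => ?_⟩
  set N := A + 2 * d + 3 with hN
  obtain ⟨N₀, hN₀⟩ := Filter.eventually_atTop.1 (eventually_log_bounds d (4 * N))
  refine ⟨2 * (2 * d) ^ (4 * N + 1) + (N₀ : ℝ) ^ α, ?_⟩
  intro n _ hn Ω _ P _ hash bin hh hbal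
  have hn₁ : (1 : ℝ) ≤ n := by exact_mod_cast (by omega : 1 ≤ n)
  have hnα : 0 < (n : ℝ) ^ (-α) := by positivity
  rcases lt_or_ge n N₀ with hlt | hge
  -- For small `n` the right side is at least `1`.
  · refine measureReal_le_one.trans ?_
    have h1 : (1 : ℝ) ≤ (N₀ : ℝ) ^ α * (n : ℝ) ^ (-α) := by
      rw [Real.rpow_neg (by linarith), ← div_eq_mul_inv, one_le_div (by positivity)]
      exact Real.rpow_le_rpow (by linarith) (by exact_mod_cast hlt.le) hα.le
    have h2 : 0 ≤ 2 * (2 * d : ℝ) ^ (4 * N + 1) * (n : ℝ) ^ (-α) := by positivity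
    linarith
  · obtain ⟨h1, h2, h3, h4, h5⟩ := hN₀ n hge
    set B := badFamilies n d ⌈Real.log n⌉₊ (4 * N) ((15 + A) * d * ⌈Real.log n⌉₊)
    have hae : P.real {ω | Real.log (Real.log n) / Real.log d + (5 * A + 40 : ℕ) * d
        < maxLoad (fun j => bin j ω)} ≤ P.real {ω | (fun j => hash j ω) ∈ B} := by
      refine ENNReal.toReal_mono (measure_ne_top _ _) (measure_mono_ae ?_)
      filter_upwards [hbal] with ω hω hmax
      exact hω.mem_badFamilies (by omega) h4 hN h2 hmax
    refine hae.trans ((hh.measureReal_mem_le B).trans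
      ((card_badFamilies_le (by omega) hN h1 h2 h3 h5).trans ?_))
    have hA : ((n : ℝ) ^ A)⁻¹ ≤ (n : ℝ) ^ (-α) := by
      rw [Real.rpow_neg (by linarith), ← Real.rpow_natCast]
      gcongr
    have h6 : 0 ≤ (N₀ : ℝ) ^ α * (n : ℝ) ^ (-α) := by positivity
    rw [div_eq_mul_inv, add_mul]
    have h7 := mul_le_mul_of_nonneg_left hA (by positivity : 0 ≤ 2 * (2 * d : ℝ) ^ (4 * N + 1))
    linarith
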